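/- Let $(X,d)$ be a complete, separable, locally compact length space (the distance of any two points is the infimum of the lengths of the continuous curves joining them), and let $\mu$ be a non-atomic Radon measure on $X$ with full support. Let $(\mathcal E,\mathcal F)$ be a regular, strongly local, symmetric Dirichlet form on $L^2(X,\mu)$, where strongly local means: $\mathcal E(f,h)=0$ for all $f,h\in\mathcal F$ with compact supports such that $f$ is constant in a neighbourhood of $\operatorname{supp} h$. Put $\mathcal E_1(u,u)=\mathcal E(u,u)+\|u\|_{L^2}^2$. For open $U\subset X$ define the following. - $\mathcal F_{\mathrm{loc}}(U)$ is the set of $u\in L^2_{\mathrm{loc}}(U,\mu)$ such that for every open $V$ whose closure is a compact subset of $U$ there is $u^\#\in\mathcal F$ with $u=u^\#$ $\mu$-a.e. on $V$. - $\mathcal F_c(U)$ is the set of $u\in\mathcal F$ whose essential support is a compact subset of $U$, and $\mathcal F^0(U)$ is the closure of $\mathcal F_c(U)$ in $\mathcal F$ for the norm $\mathcal E_1(\cdot,\cdot)^{1/2}$. - $d_U(y,z)\in[0,\infty]$ is the infimum of the lengths of the continuous curves in $U$ from $y$ to $z$ (with $\inf\emptyset=\infty$), and $d_U(A,B)=\inf_{y\in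 A,\,z\in B}d_U(y,z)$. - For open $V\subset U$, $\mathcal F^0_{\mathrm{loc}}(U,V)$ is the set of $f\in L^2_{\mathrm{loc}}(V,\mu)$ such that for every open $A\subset V$ which is relatively compact in $\overline U$ and satisfies $d_U(A,U\setminus V)>0$ there is $f^\#\in\mathcal F^0(U)$ with $f^\#=f$ $\mu$-a.e. on $A$. - A function $u:U\to\mathbb R$ is harmonic on $U$ if $u\in\mathcal F_{\mathrm{loc}}(U)$ and for every $\phi\in\mathcal F_c(U)$ there is $u^\#\in\mathcal F$ with $u^\#=u$ $\mu$-a.e. in a neighbourhood of the essential support of $\phi$ and $\mathcal E(u^\#,\phi)=0$. Let $\Omega\subset X$ be a non-empty bounded open set with $\operatorname{diam}(\Omega)\le\operatorname{diam}(X)/5$ and $$\lambda_{\min}(\Omega)=\inf_{u\in\mathcal F^0(\Omega)\setminus\{0\}}\frac{\mathcal E(u,u)}{\|u\|_{L^2}^2}>0 .$$ Let $G^\Omega=(-\mathcal L^\Omega)^{-1}$ on $L^2(\Omega,\mu)$, where $\mathcal L^\Omega$ is the generator of the form $(\mathcal E,\mathcal F^0(\Omega))$ on $L^2(\Omega,\mu)$.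 Suppose that $g_\Omega$ is a real function on $\Omega\times\Omega$ with the following properties, where $\mathrm{diag}=\{(y,y):y\in\Omega\}$. 1. For all $f\in L^2(\Omega,\mu)$ and $\mu$-a.e. $y\in\Omega$, $G^\Omega f(y)=\int_\Omega g_\Omega(y,z)f(z)\,\mu(dz)$ (the integral being absolutely convergent). 2. $g_\Omega(y,z)=g_\Omega(z,y)\ge 0$ for all $(y,z)\in(\Omega\times\Omega)\setminus\mathrm{diag}$. 3. $g_\Omega$ is jointly continuous on $(\Omega\times\Omega)\setminus\mathrm{diag}$. 4. For every open $U$ whose closure is a compact subset of $\Omega$ and every $x_0\in U$, $$\inf_{U\setminus\{x_0\}}g_\Omega(x_0,\cdot)=\inf_{\partial U}g_\Omega(x_0,\cdot),\qquad \sup_{\Omega\setminus U}g_\Omega(x_0,\cdot)=\sup_{\partial U}g_\Omega(x_0,\cdot).$$ Then for every fixed $x\in\Omega$ the function $y\mapsto g_\Omega(x,y)$ belongs to $\mathcal F^0_{\mathrm{loc}}(\Omega,\Omega\setminus\{x\})$ and is harmonic in $\Omega\setminus\{x\}$. -/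

import Mathlib

open MeasureTheory Set Filter Topology

noncomputable section

/-! ### Length spaces and the intrinsic distance -/

/-- The length of a continuous curve: the supremum over all partitions of the sums of distances. -/
def curveLength {X : Type*} [MetricSpace X] {x y : X} (γ : Path x y) : ENNReal :=
  eVariationOn γ univ

/-- A length space: the distance is the infimum of the lengths of the continuous curves
joining two points (in particular such curves exist). -/
def IsLengthSpace (X : Type*) [MetricSpace X] : Prop :=
  ∀ x y : X, edist x y = ⨅ γ : Path x y, curveLength γ

/-- The intrinsic distance `d_U`: the infimum of the lengths of the continuous curves that stay
in `U`; it is `∞` if there is no such curve of finite length. -/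
def intrinsicEDist {X : Type*} [MetricSpace X] (U : Set X) (x y : X) : ENNReal :=
  ⨅ (γ : Path x y) (_ : ∀ t, γ t ∈ U), curveLength γ

/-- The intrinsic distance `d_U(A, B)` between two sets. -/
def intrinsicSetEDist {X : Type*} [MetricSpace X] (U A B : Set X) : ENNReal :=
  ⨅ (a ∈ A) (b ∈ B), intrinsicEDist U a b

/-! ### Essential support, local square integrability -/

/-- The essential support of `f`: the complement of the largest open set on which `f = 0` a.e. -/
def essSupport {X : Type*} [TopologicalSpace X] [MeasurableSpace X] (μ : Measure X)
    (f : X → ℝ) : Set X :=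
  {x | ∀ W : Set X, IsOpen W → x ∈ W → ¬ (∀ᵐ y ∂(μ.restrict W), f y = 0)}

/-- `f ∈ L²_loc(U, μ)`; only the values of `f` on `U` matter. -/
def MemL2Loc {X : Type*} [TopologicalSpace X] [MeasurableSpace X] (μ : Measure X)
    (U : Set X) (f : X → ℝ) : Prop :=
  ∀ K : Set X, K ⊆ U → IsCompact K → MemLp f 2 (μ.restrict K)

/-! ### Dirichlet forms -/

/-- A (symmetric) Dirichlet form on `L²(X, μ)`: a densely defined, nonnegative definite, symmetric
bilinear form which is closed and on which the unit contraction operates. -/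
structure DirichletForm {X : Type*} [MeasurableSpace X] (μ : Measure X) where
  /-- the domain of the form -/
  domain : Submodule ℝ (Lp ℝ 2 μ)
  /-- the form -/
  form : domain →ₗ[ℝ] domain →ₗ[ℝ] ℝ
  dense_domain : Dense (domain : Set (Lp ℝ 2 μ))
  symm : ∀ u v : domain, form u v = form v u
  nonneg : ∀ u : domain, 0 ≤ form u u
  /-- the domain is complete for the norm `‖u‖² = form u u + ‖u‖²_{L²}` -/
  closed : ∀ u : ℕ → domain,
    (∀ ε : ℝ, 0 < ε → ∃ N : ℕ, ∀ m n : ℕ, N ≤ m → N ≤ n →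
      form (u m - u n) (u m - u n) + ‖u m - u n‖ ^ 2 < ε) →
    ∃ v : domain, Tendsto (fun n => form (u n - v) (u n - v) + ‖u n - v‖ ^ 2) atTop (𝓝 0)
  /-- the unit contraction `u ↦ (0 ∨ u) ∧ 1` maps the domain to itself and decreases the form -/
  markov : ∀ u : domain, ∃ v : domain,
    (∀ᵐ x ∂μ, (v : Lp ℝ 2 μ) x = min (max ((u : Lp ℝ 2 μ) x) 0) 1) ∧ form v v ≤ form u u

namespace DirichletForm

/-- `E₁(u, u) = E(u, u) + ‖u‖²_{L²}`. -/
def energyOne {X : Type*} [MeasurableSpace X] {μ : Measure X} (E : DirichletForm μ)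
    (u : E.domain) : ℝ :=
  E.form u u + ‖u‖ ^ 2

/-- The form is regular: the functions in the domain which are continuous with compact support are
dense in the domain for the `E₁`-norm, and dense in `C_c(X)` for the uniform norm. -/
def IsRegular {X : Type*} [TopologicalSpace X] [MeasurableSpace X] {μ : Measure X}
    (E : DirichletForm μ) : Prop :=
  (∀ u : E.domain, ∀ ε : ℝ, 0 < ε → ∃ (v : E.domain) (h : X → ℝ),
    Continuous h ∧ HasCompactSupport h ∧ (∀ᵐ x ∂μ, (v : Lp ℝ 2 μ) x = h x) ∧
      E.energyOne (u - v) < ε) ∧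
  (∀ f : X → ℝ, Continuous f → HasCompactSupport f → ∀ ε : ℝ, 0 < ε →
    ∃ (v : E.domain) (h : X → ℝ),
      Continuous h ∧ HasCompactSupport h ∧ (∀ᵐ x ∂μ, (v : Lp ℝ 2 μ) x = h x) ∧
      ∀ x, |f x - h x| < ε)

/-- The form is strongly local: `E(f, g) = 0` whenever `f` and `g` have compact (essential)
supports and `f` is constant in a neighbourhood of the support of `g`. -/
def IsStronglyLocal {X : Type*} [TopologicalSpace X] [MeasurableSpace X] {μ : Measure X}
    (E : DirichletForm μ) : Prop :=
  ∀ f g : E.domain,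
    IsCompact (essSupport μ (f : Lp ℝ 2 μ)) → IsCompact (essSupport μ (g : Lp ℝ 2 μ)) →
    (∃ (W : Set X) (c : ℝ), IsOpen W ∧ essSupport μ (g : Lp ℝ 2 μ) ⊆ W ∧
      ∀ᵐ x ∂(μ.restrict W), (f : Lp ℝ 2 μ) x = c) →
    E.form f g = 0

/-- `F_loc(U)`; only the values of `u` on `U` matter. -/
def MemFLoc {X : Type*} [TopologicalSpace X] [MeasurableSpace X] {μ : Measure X}
    (E : DirichletForm μ) (U : Set X) (u : X → ℝ) : Prop :=
  MemL2Loc μ U u ∧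
    ∀ V : Set X, IsOpen V → IsCompact (closure V) → closure V ⊆ U →
      ∃ w : E.domain, ∀ᵐ y ∂(μ.restrict V), u y = (w : Lp ℝ 2 μ) y

/-- `F_c(U)`: the elements of the domain whose essential support is a compact subset of `U`.
(An element of the domain has finite total energy `2 E(u, u)` and finite `L²`-norm, so it
satisfies every finiteness condition on `∫_U u² dμ` and on its energy measure.) -/
def FCompact {X : Type*} [TopologicalSpace X] [MeasurableSpace X] {μ : Measure X}
    (E : DirichletForm μ) (U : Set X) : Set E.domain :=
  {u | IsCompact (essSupport μ (u : Lp ℝ 2 μ)) ∧ essSupport μ (u : Lp ℝ 2 μ) ⊆ U}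

/-- `F⁰(U)`: the closure of `F_c(U)` in the domain for the `E₁`-norm. -/
def FZero {X : Type*} [TopologicalSpace X] [MeasurableSpace X] {μ : Measure X}
    (E : DirichletForm μ) (U : Set X) : Set E.domain :=
  {u | ∀ ε : ℝ, 0 < ε → ∃ v ∈ E.FCompact U, E.energyOne (u - v) < ε}

/-- `F⁰_loc(U, V)` for open sets `V ⊆ U`; only the values of `f` on `V` matter. -/
def MemFZeroLoc {X : Type*} [MetricSpace X] [MeasurableSpace X] {μ : Measure X}
    (E : DirichletForm μ) (U V : Set X) (f : X → ℝ) : Prop :=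
  MemL2Loc μ V f ∧
    ∀ A : Set X, IsOpen A → A ⊆ V → IsCompact (closure A) →
      0 < intrinsicSetEDist U A (U \ V) →
      ∃ w ∈ E.FZero U, ∀ᵐ y ∂(μ.restrict A), (w : Lp ℝ 2 μ) y = f y

/-- `u` is harmonic on the open set `U`; only the values of `u` on `U` matter. -/
def IsHarmonicOn {X : Type*} [TopologicalSpace X] [MeasurableSpace X] {μ : Measure X}
    (E : DirichletForm μ) (U : Set X) (u : X → ℝ) : Prop :=
  E.MemFLoc U u ∧
    ∀ φ ∈ E.FCompact U, ∃ w : E.domain,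
      (∃ W : Set X, IsOpen W ∧ essSupport μ (φ : Lp ℝ 2 μ) ⊆ W ∧ W ⊆ U ∧
        ∀ᵐ y ∂(μ.restrict W), (w : Lp ℝ 2 μ) y = u y) ∧
      E.form w φ = 0

/-- The bottom `λ_min(Ω)` of the Dirichlet spectrum, as a Rayleigh quotient (in `[0, ∞]`). -/
def lambdaMin {X : Type*} [TopologicalSpace X] [MeasurableSpace X] {μ : Measure X}
    (E : DirichletForm μ) (Ω : Set X) : EReal :=
  ⨅ (u : E.domain) (_ : u ∈ E.FZero Ω) (_ : u ≠ 0), ((E.form u u / ‖u‖ ^ 2 : ℝ) : EReal)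

/-- `L²(Ω, μ)`, identified with the functions in `L²(X, μ)` that vanish a.e. outside `Ω`. -/
def L2On {X : Type*} [MeasurableSpace X] (μ : Measure X) (Ω : Set X) : Set (Lp ℝ 2 μ) :=
  {f | ∀ᵐ y ∂μ, y ∉ Ω → f y = 0}

/-- The graph of the generator `L^Ω` of the part `(E, F⁰(Ω))` of the form on `Ω`: `u` is in the
domain of `L^Ω` and `L^Ω u = h`. -/
def IsGenerator {X : Type*} [TopologicalSpace X] [MeasurableSpace X] {μ : Measure X}
    (E : DirichletForm μ) (Ω : Set X) (u : E.domain) (h : Lp ℝ 2 μ) : Prop :=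
  u ∈ E.FZero Ω ∧ h ∈ L2On μ Ω ∧
    ∀ φ ∈ E.FZero Ω, E.form u φ = - inner ℝ h (φ : Lp ℝ 2 μ)

/-- The graph of the Green operator `G^Ω = (-L^Ω)⁻¹` on `L²(Ω, μ)`: `G^Ω f = u`, that is,
`-L^Ω u = f`. -/
def IsGreenOperator {X : Type*} [TopologicalSpace X] [MeasurableSpace X] {μ : Measure X}
    (E : DirichletForm μ) (Ω : Set X) (f : Lp ℝ 2 μ) (u : E.domain) : Prop :=
  E.IsGenerator Ω u (-f)

/-- `g` is a regular Green function on `Ω`. Only the values of `g` on `Ω × Ω` off the diagonal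
matter. -/
structure IsGreenFunction {X : Type*} [TopologicalSpace X] [MeasurableSpace X] {μ : Measure X}
    (E : DirichletForm μ) (Ω : Set X) (g : X → X → ℝ) : Prop where
  /-- `G^Ω f (x) = ∫_Ω g(x, z) f(z) μ(dz)` for a.e. `x ∈ Ω` (the integral exists) -/
  kernel : ∀ f ∈ L2On μ Ω, ∀ u : E.domain, E.IsGreenOperator Ω f u →
    ∀ᵐ x ∂(μ.restrict Ω), IntegrableOn (fun z => g x z * f z) Ω μ ∧
      (u : Lp ℝ 2 μ) x = ∫ z in Ω, g x z * f z ∂μ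
  symm : ∀ x ∈ Ω, ∀ y ∈ Ω, x ≠ y → g x y = g y x
  nonneg : ∀ x ∈ Ω, ∀ y ∈ Ω, x ≠ y → 0 ≤ g x y
  continuousOn : ContinuousOn (fun p : X × X => g p.1 p.2) ((Ω ×ˢ Ω) \ diagonal X)
  /-- minimum principle -/
  inf_eq : ∀ U : Set X, IsOpen U → IsCompact (closure U) → closure U ⊆ Ω → ∀ x₀ ∈ U,
    ⨅ y ∈ U \ {x₀}, (g x₀ y : EReal) = ⨅ y ∈ frontier U, (g x₀ y : EReal)
  /-- maximum principle -/
  sup_eq : ∀ U : Set X, IsOpen U → IsCompact (closure U) → closure U ⊆ Ω → ∀ x₀ ∈ U,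
    ⨆ y ∈ Ω \ U, (g x₀ y : EReal) = ⨆ y ∈ frontier U, (g x₀ y : EReal)

end DirichletForm

end

-- Fix a small closed ball `B` of radius `r` about `x`, inside `Ω`. Let `u n` be the Green potential
-- of the normalized indicator of a smaller ball `s n` shrinking to `x`. Then `E(u n, φ)` is the
-- average of `φ` over `s n` for `φ` in `F⁰(Ω)`, and `u n y` is the average of `g y` over `s n`, so
-- off the pole `u n` tends to `g x` by continuity and symmetry.
--
-- The energies of `u n` need not stay bounded, so one truncates. The maximum principle and
-- compactness give a level `M` bounding `g z y` for `z` near `x` and `y` outside the ball. So `w n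
-- = min (u n) M` agrees with `u n` there, while the Markov property gives `E(w n, w n) ≤ E(u n, w
-- n)`, an average of `w n` and hence at most `M`. The spectral gap turns this into an `E₁` bound
-- (`exists_poincare`).
--
-- Dominated convergence makes the pairings of `w n` with integrable `L²` functions converge. These
-- functions are dense, so the whole sequence has a weak limit in `F⁰(Ω)`
-- (`exists_weak_limit_FZero`), which equals `g x` on `Ω` off the ball. If `φ` is supported off `B`,
-- then `E(u n, φ) = 0` as an average of zeros and `E(u n - w n, φ) = 0` by strong locality, so the
-- limit is orthogonal to `φ`. Letting `r` depend on the set or test function at hand gives both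
-- claims.

noncomputable section

/-! ### Weak limits in Hilbert spaces -/

/-- A bounded sequence in a Hilbert space whose inner products with a dense set of vectors
converge is weakly convergent. -/
theorem exists_weak_limit_of_dense {H : Type*} [NormedAddCommGroup H] [InnerProductSpace ℝ H]
    [CompleteSpace H] {u : ℕ → H} {C : ℝ} (hC : ∀ n, ‖u n‖ ≤ C) {D : Set H} (hD : Dense D)
    (h : ∀ v ∈ D, ∃ l, Tendsto (fun n => inner ℝ (u n) v) atTop (𝓝 l)) :
    ∃ w : H, ∀ v, Tendsto (fun n => inner ℝ (u n) v) atTop (𝓝 (inner ℝ w v)) := by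
  have hC0 : 0 ≤ C := (norm_nonneg _).trans (hC 0)
  have key : ∀ v, ∃ l, Tendsto (fun n => inner ℝ (u n) v) atTop (𝓝 l) := by
    intro v
    apply cauchySeq_tendsto_of_complete
    rw [Metric.cauchySeq_iff]
    intro ε hε
    -- Using `C + 1` instead of `C` avoids dividing by zero.
    have hδ : 0 < ε / (3 * (C + 1)) := by positivity
    obtain ⟨d, hd, hvd⟩ := Metric.mem_closure_iff.1 (hD v) _ hδ
    obtain ⟨l, hl⟩ := h d hd
    obtain ⟨N, hN⟩ := Metric.cauchySeq_iff.1 hl.cauchySeq (ε / 3) (by positivity)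
    have hclose : ∀ n, |inner ℝ (u n) v - inner ℝ (u n) d| ≤ ε / 3 := by
      intro n
      rw [← inner_sub_right]
      refine (abs_real_inner_le_norm _ _).trans ?_
      rw [dist_eq_norm] at hvd
      calc ‖u n‖ * ‖v - d‖ ≤ (C + 1) * (ε / (3 * (C + 1))) := by
            apply mul_le_mul ((hC n).trans (by linarith)) hvd.le (norm_nonneg _) (by linarith)
        _ = ε / 3 := by field_simp
    refine ⟨N, fun m hm n hn => ?_⟩
    have h1 := hN m hm n hn
    have h2 := abs_le.1 (hclose m)
    have h3 := abs_le.1 (hclose n)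
    rw [Real.dist_eq, abs_lt] at h1 ⊢
    constructor <;> linarith [h1.1, h1.2, h2.1, h2.2, h3.1, h3.2]
  choose f hf using key
  -- By Banach–Steinhaus the pointwise limit is a bounded functional; Riesz then represents it.
  let T : H →L[ℝ] ℝ := continuousLinearMapOfTendsto (fun n => innerSL ℝ (u n)) (f := f)
    (tendsto_pi_nhds.2 fun v => by simpa using hf v)
  refine ⟨(InnerProductSpace.toDual ℝ H).symm T, fun v => ?_⟩
  rw [InnerProductSpace.toDual_symm_apply]
  exact hf v

/-- A sequence which is bounded in a Hilbert space `H`, continuously embedded into `L`, and whose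
image converges weakly in `L` when tested against a dense set, converges weakly in `H`. -/
theorem exists_weak_limit_of_embedding {H L : Type*} [NormedAddCommGroup H]
    [InnerProductSpace ℝ H] [CompleteSpace H] [NormedAddCommGroup L] [InnerProductSpace ℝ L]
    [CompleteSpace L] (j : H →L[ℝ] L) (hj : Function.Injective j)
    {u : ℕ → H} {C : ℝ} (hC : ∀ n, ‖u n‖ ≤ C) {D : Set L} (hD : Dense D)
    (h : ∀ v ∈ D, ∃ l, Tendsto (fun n => inner ℝ (j (u n)) v) atTop (𝓝 l)) :
    ∃ w : H, ∀ v, Tendsto (fun n => inner ℝ (u n) v) atTop (𝓝 (inner ℝ w v)) := by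
  -- The orthogonal complement of the range of the adjoint is the kernel of `j`, which is trivial.
  -- Testing `u n` in `H` on this dense range is testing `j (u n)` in `L`.
  have hr : DenseRange (ContinuousLinearMap.adjoint j) := by
    have h1 := ContinuousLinearMap.orthogonal_range (ContinuousLinearMap.adjoint j)
    rw [ContinuousLinearMap.adjoint_adjoint, LinearMap.ker_eq_bot.2 hj,
      ← Submodule.topologicalClosure_eq_top_iff, ← Submodule.dense_iff_topologicalClosure_eq_top] at h1
    exact h1
  refine exists_weak_limit_of_dense hC (hr.dense_image (ContinuousLinearMap.adjoint j).continuous hD)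
    ?_
  rintro _ ⟨v, hv, rfl⟩
  obtain ⟨l, hl⟩ := h v hv
  exact ⟨l, by simpa only [ContinuousLinearMap.adjoint_inner_right] using hl⟩

/-! ### Weak limits of bounded functions in `L²` -/

section L2

variable {X : Type*} [MeasurableSpace X] {μ : Measure X}

theorem dense_integrable_L2 : Dense {h : Lp ℝ 2 μ | Integrable h μ} := by
  refine (Lp.simpleFunc.dense (E := ℝ) (p := 2) (μ := μ) (by norm_num)).mono ?_
  intro h hh
  have h1 := Lp.simpleFunc.toSimpleFunc_eq_toFun (⟨h, hh⟩ : Lp.simpleFunc ℝ 2 μ)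
  have h2 := Lp.simpleFunc.memLp (⟨h, hh⟩ : Lp.simpleFunc ℝ 2 μ)
  rw [SimpleFunc.memLp_iff_integrable (by norm_num) (by norm_num)] at h2
  exact h2.congr h1

theorem inner_L2_eq (f h : Lp ℝ 2 μ) : inner ℝ f h = ∫ x, f x * h x ∂μ := by
  rw [L2.inner_def]
  simp [mul_comm]

theorem tendsto_inner_of_bounded {w : ℕ → Lp ℝ 2 μ} {f : X → ℝ} {M : ℝ}
    (hM : ∀ n, ∀ᵐ x ∂μ, |w n x| ≤ M) (hf : ∀ᵐ x ∂μ, Tendsto (fun n => w n x) atTop (𝓝 (f x)))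
    {h : Lp ℝ 2 μ} (hh : Integrable h μ) :
    Tendsto (fun n => inner ℝ (w n) h) atTop (𝓝 (∫ x, f x * h x ∂μ)) := by
  simp only [inner_L2_eq]
  refine tendsto_integral_of_dominated_convergence (fun x => M * |h x|) (fun n => ?_)
    (hh.abs.const_mul M) (fun n => ?_) ?_
  · exact (Lp.aestronglyMeasurable _).mul (Lp.aestronglyMeasurable _)
  · filter_upwards [hM n] with x hx
    rw [Real.norm_eq_abs, abs_mul]
    gcongr
  · filter_upwards [hf] with x hx
    exact hx.mul_const _

/-- Testing against indicators of sets of finite measure computes the integrals of `v` by weak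
convergence and those of `f` by dominated convergence; σ-finiteness then separates functions. -/
theorem ae_eq_of_weak_limit_of_bounded [SigmaFinite μ] {w : ℕ → Lp ℝ 2 μ} {f : X → ℝ} {M : ℝ}
    (hM : ∀ n, ∀ᵐ x ∂μ, |w n x| ≤ M) (hf : ∀ᵐ x ∂μ, Tendsto (fun n => w n x) atTop (𝓝 (f x)))
    {v : Lp ℝ 2 μ}
    (hv : ∀ h : Lp ℝ 2 μ, Tendsto (fun n => inner ℝ (w n) h) atTop (𝓝 (inner ℝ v h))) :
    v =ᵐ[μ] f := by
  have hfM : ∀ᵐ x ∂μ, |f x| ≤ M := by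
    filter_upwards [hf, ae_all_iff.2 hM] with x hx hx'
    exact le_of_tendsto hx.abs (Eventually.of_forall hx')
  have hfm : AEStronglyMeasurable f μ :=
    aestronglyMeasurable_of_tendsto_ae atTop (fun n => Lp.aestronglyMeasurable (w n)) hf
  refine ae_eq_of_forall_setIntegral_eq_of_sigmaFinite ?_ ?_ ?_
  · intro s hs hμ
    exact integrableOn_Lp_of_measure_ne_top v (by norm_num) hμ.ne
  · intro s hs hμ
    refine Measure.integrableOn_of_bounded (M := M) hμ.ne hfm (ae_restrict_of_ae ?_)
    simpa [Real.norm_eq_abs] using hfM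
  · intro s hs hμ
    have hi : Integrable (indicatorConstLp 2 hs hμ.ne (1 : ℝ) : Lp ℝ 2 μ) μ :=
      ((integrable_indicator_iff hs).2 (integrableOn_const hμ.ne)).congr
        indicatorConstLp_coeFn.symm
    have h1 := tendsto_nhds_unique (hv _) (tendsto_inner_of_bounded hM hf hi)
    rw [real_inner_comm, L2.inner_indicatorConstLp_one] at h1
    rw [h1, ← integral_indicator hs]
    refine integral_congr_ae ?_
    filter_upwards [indicatorConstLp_coeFn (p := 2) (hs := hs) (hμs := hμ.ne) (c := (1 : ℝ))]
      with x hx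
    rw [hx]
    by_cases hxs : x ∈ s <;> simp [hxs]

end L2

/-! ### Essential supports and the spaces `F_c(U)` -/

section Support

variable {X : Type*} [TopologicalSpace X] [MeasurableSpace X] {μ : Measure X}

theorem essSupport_subset_of_isClosed [OpensMeasurableSpace X] {f : X → ℝ} {K : Set X}
    (hK : IsClosed K) (h : ∀ᵐ y ∂μ, y ∉ K → f y = 0) : essSupport μ f ⊆ K := by
  intro x hx
  by_contra hxK
  exact hx Kᶜ hK.isOpen_compl hxK ((ae_restrict_iff' hK.measurableSet.compl).2 h)

theorem isClosed_essSupport (f : X → ℝ) : IsClosed (essSupport μ f) := by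
  rw [← isOpen_compl_iff, isOpen_iff_forall_mem_open]
  intro x hx
  simp only [essSupport, mem_compl_iff, mem_ofPred_eq, not_forall, not_not] at hx
  obtain ⟨W, hW, hxW, h⟩ := hx
  exact ⟨W, fun y hy hy' => hy' W hW hy h, hW, hxW⟩

theorem ae_eq_zero_of_notMem_essSupport [SecondCountableTopology X] [OpensMeasurableSpace X]
    (f : X → ℝ) : ∀ᵐ y ∂μ, y ∉ essSupport μ f → f y = 0 := by
  rw [ae_iff]
  refine measure_null_of_locally_null _ fun x hx => ?_
  simp only [essSupport, Classical.not_imp, mem_ofPred_eq, not_forall, not_not] at hx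
  obtain ⟨⟨W, hW, hxW, h⟩, -⟩ := hx
  rw [ae_restrict_iff' hW.measurableSet, ae_iff] at h
  refine ⟨W ∩ _, inter_mem (mem_nhdsWithin_of_mem_nhds (hW.mem_nhds hxW)) self_mem_nhdsWithin,
    measure_mono_null ?_ h⟩
  rintro y ⟨hyW, hy⟩
  simp only [Classical.not_imp, mem_ofPred_eq] at hy ⊢
  exact ⟨hyW, hy.2⟩

namespace DirichletForm

/-- Second countability makes the function vanish a.e. off its essential support, so any compact set
carrying the function may replace that support. This form is stable under sums and truncation. -/
theorem mem_FCompact_iff [SecondCountableTopology X] [T2Space X] [OpensMeasurableSpace X]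
    (E : DirichletForm μ) (U : Set X) (u : E.domain) :
    u ∈ E.FCompact U ↔
      ∃ K, IsCompact K ∧ K ⊆ U ∧ ∀ᵐ y ∂μ, y ∉ K → (u : Lp ℝ 2 μ) y = 0 := by
  constructor
  · exact fun h => ⟨_, h.1, h.2, ae_eq_zero_of_notMem_essSupport _⟩
  · rintro ⟨K, hK, hKU, h⟩
    have hs := essSupport_subset_of_isClosed hK.isClosed h
    exact ⟨hK.of_isClosed_subset (isClosed_essSupport _) hs, hs.trans hKU⟩

end DirichletForm

end Support

namespace DirichletForm

/-! ### The Hilbert space of a Dirichlet form -/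

/-- The domain of a Dirichlet form, with the inner product `E₁`. -/
def FormSpace {X : Type*} [MeasurableSpace X] {μ : Measure X} (E : DirichletForm μ) : Type _ :=
  E.domain

variable {X : Type*} [MeasurableSpace X] {μ : Measure X} (E : DirichletForm μ)

instance : AddCommGroup E.FormSpace := inferInstanceAs (AddCommGroup E.domain)

instance : Module ℝ E.FormSpace := inferInstanceAs (Module ℝ E.domain)

/-- The identity from the domain to the Hilbert space of the form. -/
def toFormSpace : E.domain ≃ₗ[ℝ] E.FormSpace := LinearEquiv.refl ℝ E.domain

/-- The inner product `E₁` on the Hilbert space of the form. -/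
@[reducible]
def formSpaceCore : InnerProductSpace.Core ℝ E.FormSpace where
  inner u v := E.form (E.toFormSpace.symm u) (E.toFormSpace.symm v) +
    inner ℝ (E.toFormSpace.symm u : Lp ℝ 2 μ) (E.toFormSpace.symm v : Lp ℝ 2 μ)
  conj_inner_symm u v := by
    simp only [conj_trivial]
    rw [E.symm, real_inner_comm]
  re_inner_nonneg u := add_nonneg (E.nonneg _) real_inner_self_nonneg
  add_left u v w := by
    simp only [map_add, LinearMap.add_apply, Submodule.coe_add, inner_add_left]
    ring
  smul_left u v r := by
    simp only [map_smul, LinearMap.smul_apply, Submodule.coe_smul, real_inner_smul_left, smul_eq_mul,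
      conj_trivial]
    ring
  definite u hu := by
    have h1 := E.nonneg (E.toFormSpace.symm u)
    have h2 : (0 : ℝ) ≤ inner ℝ (E.toFormSpace.symm u : Lp ℝ 2 μ) (E.toFormSpace.symm u) :=
      real_inner_self_nonneg
    have h3 : inner ℝ (E.toFormSpace.symm u : Lp ℝ 2 μ) (E.toFormSpace.symm u) = (0 : ℝ) := by
      linarith
    exact E.toFormSpace.symm.map_eq_zero_iff.1 (Subtype.ext (inner_self_eq_zero.1 h3))

instance : NormedAddCommGroup E.FormSpace :=
  @InnerProductSpace.Core.toNormedAddCommGroup ℝ _ _ _ _ E.formSpaceCore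

instance : InnerProductSpace ℝ E.FormSpace := InnerProductSpace.ofCore E.formSpaceCore.toCore

theorem inner_toFormSpace (u v : E.domain) :
    inner ℝ (E.toFormSpace u) (E.toFormSpace v) =
      E.form u v + inner ℝ (u : Lp ℝ 2 μ) (v : Lp ℝ 2 μ) := rfl

theorem norm_toFormSpace_sq (u : E.domain) : ‖E.toFormSpace u‖ ^ 2 = E.energyOne u := by
  rw [← real_inner_self_eq_norm_sq, inner_toFormSpace, real_inner_self_eq_norm_sq]
  rfl

instance : CompleteSpace E.FormSpace := by
  refine Metric.complete_of_cauchySeq_tendsto fun u hu => ?_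
  obtain ⟨v, hv⟩ := E.closed (fun n => E.toFormSpace.symm (u n)) (by
    intro ε hε
    obtain ⟨N, hN⟩ := Metric.cauchySeq_iff.1 hu (√ε) (Real.sqrt_pos.2 hε)
    refine ⟨N, fun m n hm hn => ?_⟩
    have h1 := hN m hm n hn
    rw [dist_eq_norm, Real.lt_sqrt (norm_nonneg _)] at h1
    rw [← map_sub]
    exact (E.norm_toFormSpace_sq (E.toFormSpace.symm (u m - u n))).symm.trans_lt h1)
  refine ⟨E.toFormSpace v, ?_⟩
  rw [tendsto_iff_norm_sub_tendsto_zero]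
  have h2 : Tendsto (fun n => √(‖u n - E.toFormSpace v‖ ^ 2)) atTop (𝓝 (√0)) := by
    refine (Real.continuous_sqrt.tendsto 0).comp ?_
    refine hv.congr fun n => ?_
    exact (E.norm_toFormSpace_sq (E.toFormSpace.symm (u n) - v)).symm
  simpa using h2

/-- The embedding of the Hilbert space of the form into `L²`. -/
def embedding : E.FormSpace →L[ℝ] Lp ℝ 2 μ :=
  LinearMap.mkContinuous (E.domain.subtype ∘ₗ E.toFormSpace.symm.toLinearMap) 1 fun u => by
    rw [one_mul]
    refine abs_le_of_sq_le_sq' ?_ (norm_nonneg _) |>.2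
    have h := E.norm_toFormSpace_sq (E.toFormSpace.symm u)
    rw [LinearEquiv.apply_symm_apply] at h
    rw [h]
    exact le_add_of_nonneg_left (E.nonneg _)

@[simp]
theorem embedding_toFormSpace (u : E.domain) : E.embedding (E.toFormSpace u) = u := rfl

theorem embedding_injective : Function.Injective E.embedding :=
  Subtype.val_injective.comp E.toFormSpace.symm.injective

end DirichletForm


namespace DirichletForm

/-! ### The spaces `F⁰(U)` -/

section Basic

variable {X : Type*} [TopologicalSpace X] [MeasurableSpace X] {μ : Measure X}
  {E : DirichletForm μ} {U : Set X}

theorem FCompact_subset_FZero : E.FCompact U ⊆ E.FZero U := by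
  intro u hu ε hε
  refine ⟨u, hu, ?_⟩
  simpa [energyOne] using hε

theorem FCompact_mono {V : Set X} (h : U ⊆ V) : E.FCompact U ⊆ E.FCompact V :=
  fun _ hu => ⟨hu.1, hu.2.trans h⟩

/-- A spectral gap is a Poincaré inequality on `F⁰(U)`. -/
theorem exists_poincare (h : 0 < E.lambdaMin U) :
    ∃ c : ℝ, 0 < c ∧ ∀ u ∈ E.FZero U, c * ‖(u : Lp ℝ 2 μ)‖ ^ 2 ≤ E.form u u := by
  obtain ⟨c, hc0, hc⟩ := EReal.lt_iff_exists_real_btwn.1 h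
  refine ⟨c, by exact_mod_cast hc0, fun u hu => ?_⟩
  rcases eq_or_ne u 0 with rfl | hne
  · simp
  · have h1 : (c : EReal) ≤ ((E.form u u / ‖u‖ ^ 2 : ℝ) : EReal) :=
      hc.le.trans (iInf_le_of_le u (iInf_le_of_le hu (iInf_le_of_le hne le_rfl)))
    have h2 : 0 < ‖u‖ ^ 2 := by positivity
    exact (le_div_iff₀ h2).1 (EReal.coe_le_coe_iff.1 h1)

end Basic

section FZero

variable {X : Type*} [TopologicalSpace X] [SecondCountableTopology X] [T2Space X]
  [MeasurableSpace X] [OpensMeasurableSpace X] {μ : Measure X} (E : DirichletForm μ) (U : Set X)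

/-- `F_c(U)` as a subspace of the Hilbert space of the form. -/
def FCompactSubmodule : Submodule ℝ E.FormSpace where
  carrier := {u | E.toFormSpace.symm u ∈ E.FCompact U}
  zero_mem' := by
    refine (E.mem_FCompact_iff U _).2 ⟨∅, isCompact_empty, empty_subset _, ?_⟩
    filter_upwards [Lp.coeFn_zero ℝ 2 μ] with y hy _
    exact hy
  add_mem' := by
    intro u v hu hv
    obtain ⟨K, hK, hKU, h⟩ := (E.mem_FCompact_iff U (E.toFormSpace.symm u)).1 hu
    obtain ⟨K', hK', hKU', h'⟩ := (E.mem_FCompact_iff U (E.toFormSpace.symm v)).1 hv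
    refine (E.mem_FCompact_iff U _).2 ⟨K ∪ K', hK.union hK', union_subset hKU hKU', ?_⟩
    filter_upwards [h, h', Lp.coeFn_add (E.toFormSpace.symm u : Lp ℝ 2 μ) (E.toFormSpace.symm v)]
      with y hy hy' ha hyK
    rw [mem_union, not_or] at hyK
    change ((E.toFormSpace.symm u + E.toFormSpace.symm v : E.domain) : Lp ℝ 2 μ) y = 0
    rw [Submodule.coe_add, ha, Pi.add_apply, hy hyK.1, hy' hyK.2, add_zero]
  smul_mem' := by
    intro c u hu
    obtain ⟨K, hK, hKU, h⟩ := (E.mem_FCompact_iff U (E.toFormSpace.symm u)).1 hu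
    refine (E.mem_FCompact_iff U _).2 ⟨K, hK, hKU, ?_⟩
    filter_upwards [h, Lp.coeFn_smul c (E.toFormSpace.symm u : Lp ℝ 2 μ)] with y hy hs hyK
    change ((c • E.toFormSpace.symm u : E.domain) : Lp ℝ 2 μ) y = 0
    rw [Submodule.coe_smul, hs, Pi.smul_apply, hy hyK, smul_zero]

/-- `F⁰(U)` as a closed subspace of the Hilbert space of the form. -/
def FZeroSubmodule : Submodule ℝ E.FormSpace := (E.FCompactSubmodule U).topologicalClosure

variable {E U}

theorem toFormSpace_mem_FZeroSubmodule {u : E.domain} :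
    E.toFormSpace u ∈ E.FZeroSubmodule U ↔ u ∈ E.FZero U := by
  rw [FZeroSubmodule, ← SetLike.mem_coe, Submodule.topologicalClosure_coe, Metric.mem_closure_iff]
  constructor
  · intro h ε hε
    obtain ⟨v, hv, hd⟩ := h (√ε) (Real.sqrt_pos.2 hε)
    refine ⟨E.toFormSpace.symm v, hv, ?_⟩
    rw [dist_eq_norm, Real.lt_sqrt (norm_nonneg _)] at hd
    rwa [← norm_toFormSpace_sq, map_sub, LinearEquiv.apply_symm_apply]
  · intro h ε hε
    obtain ⟨v, hv, hd⟩ := h (ε ^ 2) (by positivity)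
    refine ⟨E.toFormSpace v, hv, ?_⟩
    rw [← norm_toFormSpace_sq, map_sub] at hd
    rw [dist_eq_norm]
    exact lt_of_pow_lt_pow_left₀ 2 hε.le hd

instance : CompleteSpace (E.FZeroSubmodule U) :=
  (Submodule.isClosed_topologicalClosure _).completeSpace_coe

/-- A sequence in `F⁰(U)` which is bounded in energy and converges in `L²` when tested against a
dense set of functions converges weakly, in energy and in `L²`, to an element of `F⁰(U)`. -/
theorem exists_weak_limit_FZero {u : ℕ → E.domain} (hu : ∀ n, u n ∈ E.FZero U) {C : ℝ}
    (hC : ∀ n, E.energyOne (u n) ≤ C) {D : Set (Lp ℝ 2 μ)} (hD : Dense D)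
    (h : ∀ v ∈ D, ∃ l, Tendsto (fun n => inner ℝ (u n : Lp ℝ 2 μ) v) atTop (𝓝 l)) :
    ∃ w ∈ E.FZero U,
      (∀ v : E.domain, Tendsto (fun n => E.form (u n) v) atTop (𝓝 (E.form w v))) ∧
      ∀ v : Lp ℝ 2 μ, Tendsto (fun n => inner ℝ (u n : Lp ℝ 2 μ) v) atTop
        (𝓝 (inner ℝ (w : Lp ℝ 2 μ) v)) := by
  obtain ⟨w, hw⟩ := exists_weak_limit_of_embedding E.embedding E.embedding_injective
    (u := fun n => E.toFormSpace (u n)) (C := √C)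
    (fun n => Real.le_sqrt_of_sq_le (by rw [norm_toFormSpace_sq]; exact hC n)) hD h
  have hL : ∀ v : Lp ℝ 2 μ, Tendsto (fun n => inner ℝ (u n : Lp ℝ 2 μ) v) atTop
        (𝓝 (inner ℝ (E.embedding w) v)) := by
    intro v
    have := hw (ContinuousLinearMap.adjoint E.embedding v)
    simpa only [ContinuousLinearMap.adjoint_inner_right, embedding_toFormSpace] using this
  refine ⟨E.toFormSpace.symm w, ?_, fun v => ?_, hL⟩
  -- A closed subspace is its own double orthogonal complement, hence weakly closed.
  · rw [← toFormSpace_mem_FZeroSubmodule, LinearEquiv.apply_symm_apply,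
      ← Submodule.orthogonal_orthogonal (E.FZeroSubmodule U), Submodule.mem_orthogonal']
    intro v hv
    refine tendsto_nhds_unique (hw v) (tendsto_const_nhds.congr fun n => ?_)
    rw [Submodule.mem_orthogonal] at hv
    exact (hv _ (toFormSpace_mem_FZeroSubmodule.2 (hu n))).symm
  · have := (hw (E.toFormSpace v)).sub (hL v)
    have h2 : inner ℝ w (E.toFormSpace v) - inner ℝ (E.embedding w) (v : Lp ℝ 2 μ) =
        E.form (E.toFormSpace.symm w) v := by
      have := E.inner_toFormSpace (E.toFormSpace.symm w) v
      rw [LinearEquiv.apply_symm_apply] at this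
      rw [this]
      exact add_sub_cancel_right _ _
    rw [h2] at this
    refine this.congr fun n => ?_
    rw [inner_toFormSpace, add_sub_cancel_right]

/-- Elements of `F⁰(U)` vanish outside `U`. -/
theorem ae_eq_zero_of_mem_FZero {u : E.domain} (hU : IsOpen U) (hu : u ∈ E.FZero U) :
    ∀ᵐ y ∂μ, y ∉ U → (u : Lp ℝ 2 μ) y = 0 := by
  have h1 : eLpNorm (u : Lp ℝ 2 μ) 2 (μ.restrict Uᶜ) = 0 := by
    refine le_antisymm (ENNReal.le_of_forall_pos_le_add fun ε hε _ => ?_) zero_le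
    rw [zero_add]
    obtain ⟨v, hv, hd⟩ := hu (ε ^ 2) (by positivity)
    obtain ⟨K, -, hKU, h⟩ := (E.mem_FCompact_iff U v).1 hv
    have h2 : (u : Lp ℝ 2 μ) =ᵐ[μ.restrict Uᶜ] ((u - v : E.domain) : Lp ℝ 2 μ) := by
      refine (ae_restrict_iff' hU.measurableSet.compl).2 ?_
      filter_upwards [h, Lp.coeFn_sub (u : Lp ℝ 2 μ) v] with y hy hs hyU
      rw [Submodule.coe_sub, hs, Pi.sub_apply, hy fun hyK => hyU (hKU hyK), sub_zero]
    rw [eLpNorm_congr_ae h2]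
    refine (eLpNorm_mono_measure _ Measure.restrict_le_self).trans ?_
    rw [← Lp.enorm_def, ← ofReal_norm, ENNReal.ofReal_le_iff_le_toReal ENNReal.coe_ne_top,
      ENNReal.coe_toReal]
    refine abs_le_of_sq_le_sq' (le_trans ?_ hd.le) ε.2 |>.2
    exact le_add_of_nonneg_left (E.nonneg _)
  rw [eLpNorm_eq_zero_iff (Lp.aestronglyMeasurable _).restrict (by norm_num)] at h1
  exact (ae_restrict_iff' hU.measurableSet.compl).1 h1

end FZero

/-! ### Truncations -/

section Truncation

variable {X : Type*} [MeasurableSpace X] {μ : Measure X} {E : DirichletForm μ}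

theorem exists_truncation (u : E.domain) {M : ℝ} (hM : 0 < M) : ∃ v : E.domain,
    (∀ᵐ x ∂μ, (v : Lp ℝ 2 μ) x = min (max ((u : Lp ℝ 2 μ) x) 0) M) ∧
      E.form v v ≤ E.form u u := by
  obtain ⟨v, hv, hle⟩ := E.markov (M⁻¹ • u)
  refine ⟨M • v, ?_, ?_⟩
  · filter_upwards [hv, Lp.coeFn_smul M (v : Lp ℝ 2 μ), Lp.coeFn_smul M⁻¹ (u : Lp ℝ 2 μ)]
      with x hx h1 h2
    rw [Submodule.coe_smul, h1, Pi.smul_apply, hx, Submodule.coe_smul, h2, Pi.smul_apply,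
      smul_eq_mul, smul_eq_mul, mul_min_of_nonneg _ _ hM.le, mul_max_of_nonneg _ _ hM.le,
      mul_inv_cancel_left₀ hM.ne', mul_zero, mul_one]
  · simp only [map_smul, LinearMap.smul_apply, smul_eq_mul] at hle ⊢
    calc M * (M * E.form v v) ≤ M * (M * (M⁻¹ * (M⁻¹ * E.form u u))) := by gcongr
      _ = E.form u u := by field_simp

/-- The part of a nonnegative function below a level and the part above it have a nonnegative
mutual energy. -/
theorem form_truncation_le {u v : E.domain} {M : ℝ} (hM : 0 < M)
    (hu : ∀ᵐ x ∂μ, 0 ≤ (u : Lp ℝ 2 μ) x)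
    (hv : ∀ᵐ x ∂μ, (v : Lp ℝ 2 μ) x = min ((u : Lp ℝ 2 μ) x) M) :
    E.form v v ≤ E.form u v := by
  set d := u - v with hd
  -- Since `d` is nonzero only where `v = M`, truncating `v + t • d` at `M` returns `v`. The Markov
  -- property then compares the two energies; divide by `t` and let `t` tend to `0`.
  have key : ∀ t : ℝ, 0 < t → 0 ≤ 2 * E.form d v + t * E.form d d := by
    intro t ht
    obtain ⟨w, hw, hle⟩ := exists_truncation (v + t • d) hM
    have hwv : w = v := by
      refine Subtype.ext (Lp.ext ?_)
      filter_upwards [hu, hv, hw, Lp.coeFn_add (v : Lp ℝ 2 μ) (t • d : E.domain),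
        Lp.coeFn_smul t (d : Lp ℝ 2 μ), Lp.coeFn_sub (u : Lp ℝ 2 μ) v] with x h1 h2 h3 h4 h5 h6
      rw [h3, Submodule.coe_add, h4, Pi.add_apply, Submodule.coe_smul, h5, Pi.smul_apply, hd,
        Submodule.coe_sub, h6, Pi.sub_apply, h2, smul_eq_mul]
      rcases le_total ((u : Lp ℝ 2 μ) x) M with h | h
      · rw [min_eq_left h, sub_self, mul_zero, add_zero, max_eq_left h1, min_eq_left h]
      · have : 0 ≤ t * ((u : Lp ℝ 2 μ) x - M) := mul_nonneg ht.le (by linarith)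
        rw [min_eq_right h, max_eq_left (by linarith), min_eq_right (by linarith)]
    rw [hwv] at hle
    simp only [map_add, map_smul, LinearMap.add_apply, LinearMap.smul_apply, smul_eq_mul,
      E.symm v d] at hle
    have : 0 ≤ t * (2 * E.form d v + t * E.form d d) := by linarith
    exact nonneg_of_mul_nonneg_right this ht
  have hlim : Tendsto (fun t : ℝ => 2 * E.form d v + t * E.form d d) (𝓝[>] 0)
      (𝓝 (2 * E.form d v + 0 * E.form d d)) :=
    ((continuous_const.add (continuous_id.mul continuous_const)).tendsto 0).mono_left
      nhdsWithin_le_nhds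
  have h0 := ge_of_tendsto hlim (eventually_mem_nhdsWithin.mono fun t ht => key t ht)
  rw [hd, map_sub, LinearMap.sub_apply] at h0
  linarith

theorem abs_truncation_sub_le (a b M : ℝ) :
    |min (max a 0) M - min (max b 0) M| ≤ |a - b| :=
  (abs_min_sub_min_le_max _ _ _ _).trans (by
    simpa using abs_max_sub_max_le_max a 0 b 0)

theorem abs_truncation_le {M : ℝ} (hM : 0 ≤ M) (a : ℝ) : |min (max a 0) M| ≤ |a| := by
  have := abs_truncation_sub_le a 0 M
  simpa [hM] using this

end Truncation

section FZeroTruncation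

variable {X : Type*} [TopologicalSpace X] [SecondCountableTopology X] [T2Space X]
  [MeasurableSpace X] [OpensMeasurableSpace X] {μ : Measure X} {E : DirichletForm μ} {U : Set X}

/-- Truncations of compactly supported approximants of `u` are bounded in energy and converge to `v`
in `L²`, because truncation is 1-Lipschitz. Their weak limit in `F⁰(U)` must be `v`; strong
convergence in energy is not needed. -/
theorem truncation_mem_FZero {u v : E.domain} (hu : u ∈ E.FZero U) {M : ℝ} (hM : 0 < M)
    (hv : ∀ᵐ x ∂μ, (v : Lp ℝ 2 μ) x = min (max ((u : Lp ℝ 2 μ) x) 0) M) : v ∈ E.FZero U := by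
  have hex : ∀ n : ℕ, ∃ a ∈ E.FCompact U, E.energyOne (u - a) < (1 / ((n : ℝ) + 1)) ^ 2 :=
    fun n => hu _ (by positivity)
  choose a ha hau using hex
  choose b hb hba using fun n => exists_truncation (a n) hM
  have hlt : ∀ n : ℕ, ‖E.toFormSpace u - E.toFormSpace (a n)‖ < 1 / ((n : ℝ) + 1) := fun n => by
    have := hau n
    rw [← norm_toFormSpace_sq, map_sub] at this
    exact lt_of_pow_lt_pow_left₀ 2 (by positivity) this
  have hbF : ∀ n, b n ∈ E.FZero U := by
    intro n
    obtain ⟨K, hK, hKU, h⟩ := (E.mem_FCompact_iff U _).1 (ha n)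
    refine FCompact_subset_FZero ((E.mem_FCompact_iff U _).2 ⟨K, hK, hKU, ?_⟩)
    filter_upwards [h, hb n] with y h1 h2 hy
    rw [h2, h1 hy]
    simp [hM.le]
  have hbE : ∀ n, E.energyOne (b n) ≤ (‖E.toFormSpace u‖ + 1) ^ 2 := by
    intro n
    have h1 : ‖(b n : Lp ℝ 2 μ)‖ ≤ ‖(a n : Lp ℝ 2 μ)‖ := by
      refine Lp.norm_le_norm_of_ae_le ?_
      filter_upwards [hb n] with y hy
      rw [hy]
      exact abs_truncation_le hM.le _
    have h2 : ‖E.toFormSpace (a n)‖ ≤ ‖E.toFormSpace u‖ + 1 := by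
      have h3 := norm_sub_norm_le (E.toFormSpace (a n)) (E.toFormSpace u)
      rw [norm_sub_rev] at h3
      have h4 : 1 / ((n : ℝ) + 1) ≤ 1 := by
        rw [div_le_one (by positivity)]
        linarith [n.cast_nonneg (α := ℝ)]
      linarith [hlt n]
    calc E.energyOne (b n) ≤ E.energyOne (a n) :=
          add_le_add (hba n) (pow_le_pow_left₀ (norm_nonneg _) h1 2)
      _ = ‖E.toFormSpace (a n)‖ ^ 2 := (E.norm_toFormSpace_sq _).symm
      _ ≤ _ := pow_le_pow_left₀ (norm_nonneg _) h2 2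
  have hbv : Tendsto (fun n => (b n : Lp ℝ 2 μ)) atTop (𝓝 (v : Lp ℝ 2 μ)) := by
    rw [tendsto_iff_norm_sub_tendsto_zero]
    refine squeeze_zero (fun _ => norm_nonneg _) (fun n => ?_)
      tendsto_one_div_add_atTop_nhds_zero_nat
    have h1 : ‖(b n : Lp ℝ 2 μ) - v‖ ≤ ‖(u : Lp ℝ 2 μ) - a n‖ := by
      refine Lp.norm_le_norm_of_ae_le ?_
      filter_upwards [hb n, hv, Lp.coeFn_sub (b n : Lp ℝ 2 μ) v,
        Lp.coeFn_sub (u : Lp ℝ 2 μ) (a n)] with y h1 h2 h3 h4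
      rw [h3, h4, Pi.sub_apply, Pi.sub_apply, h1, h2, Real.norm_eq_abs, Real.norm_eq_abs,
        abs_sub_comm (((u : Lp ℝ 2 μ) : X → ℝ) y)]
      exact abs_truncation_sub_le _ _ _
    refine h1.trans (le_trans ?_ (hlt n).le)
    have h5 := E.norm_toFormSpace_sq (u - a n)
    rw [map_sub] at h5
    refine abs_le_of_sq_le_sq' ?_ (norm_nonneg _) |>.2
    rw [h5]
    exact le_add_of_nonneg_left (E.nonneg _)
  obtain ⟨w, hw, -, hwL⟩ := exists_weak_limit_FZero hbF hbE dense_univ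
    (fun z _ => ⟨inner ℝ (v : Lp ℝ 2 μ) z, hbv.inner tendsto_const_nhds⟩)
  have : w = v := by
    refine Subtype.ext (ext_inner_right ℝ fun z => ?_)
    exact tendsto_nhds_unique (hwL z) (hbv.inner tendsto_const_nhds)
  exact this ▸ hw

/-! ### The Green operator -/

/-- With a spectral gap, `-L^U` is onto `L²(U)`. -/
theorem exists_isGreenOperator (h : 0 < E.lambdaMin U) {f : Lp ℝ 2 μ} (hf : f ∈ L2On μ U) :
    ∃ u : E.domain, E.IsGreenOperator U f u := by
  obtain ⟨c, hc, hpoin⟩ := exists_poincare h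
  let j : E.FZeroSubmodule U →L[ℝ] Lp ℝ 2 μ := E.embedding ∘L (E.FZeroSubmodule U).subtypeL
  -- `E` is recovered as `E₁` minus the `L²` product, which makes its continuity immediate;
  -- Lax–Milgram then solves the equation.
  let B : E.FZeroSubmodule U →L[ℝ] E.FZeroSubmodule U →L[ℝ] ℝ :=
    innerSL ℝ - (innerSL ℝ).bilinearComp j j
  have hB : ∀ u v, B u v = E.form (E.toFormSpace.symm u) (E.toFormSpace.symm v) := by
    intro u v
    have h1 := E.inner_toFormSpace (E.toFormSpace.symm u) (E.toFormSpace.symm v)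
    rw [LinearEquiv.apply_symm_apply, LinearEquiv.apply_symm_apply] at h1
    have h2 : B u v = inner ℝ (u : E.FormSpace) v - inner ℝ (j u) (j v) := rfl
    rw [h2, h1]
    exact add_sub_cancel_right _ _
  have hcoer : IsCoercive B := by
    -- The Poincaré inequality gives `E₁ ≤ (1 + 1/c) E`.
    refine ⟨c / (c + 1), by positivity, fun u => ?_⟩
    have h1 := E.norm_toFormSpace_sq (E.toFormSpace.symm u)
    rw [LinearEquiv.apply_symm_apply, energyOne] at h1
    have h2 := hpoin (E.toFormSpace.symm u)
      (toFormSpace_mem_FZeroSubmodule.1 (by rw [LinearEquiv.apply_symm_apply]; exact u.2))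
    rw [← Submodule.coe_norm] at h2
    rw [hB, mul_assoc, ← sq, Submodule.coe_norm, h1, div_mul_eq_mul_div, div_le_iff₀ (by positivity)]
    linarith
  let u := hcoer.continuousLinearEquivOfBilin.symm
    ((InnerProductSpace.toDual ℝ (E.FZeroSubmodule U)).symm ((innerSL ℝ f) ∘L j))
  have hu : ∀ v, B u v = inner ℝ f (j v) := by
    intro v
    rw [← hcoer.continuousLinearEquivOfBilin_apply, ContinuousLinearEquiv.apply_symm_apply,
      InnerProductSpace.toDual_symm_apply]
    rfl
  refine ⟨E.toFormSpace.symm u, ?_, ?_, ?_⟩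
  · refine toFormSpace_mem_FZeroSubmodule.1 ?_
    rw [LinearEquiv.apply_symm_apply]
    exact u.2
  · filter_upwards [hf, Lp.coeFn_neg f] with y hy hn hyU
    rw [hn, Pi.neg_apply, hy hyU, neg_zero]
  · intro φ hφ
    rw [inner_neg_left, neg_neg]
    have := hu ⟨E.toFormSpace φ, toFormSpace_mem_FZeroSubmodule.2 hφ⟩
    rwa [hB] at this

end FZeroTruncation

end DirichletForm


/-! ### The intrinsic distance near a point -/

/-- In a length space, a set at positive intrinsic distance in `U` from an interior point `x` of
`U` stays away from `x`. -/
theorem notMem_closure_of_intrinsicSetEDist_pos {X : Type*} [MetricSpace X]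
    (hX : IsLengthSpace X) {U A : Set X} (hU : IsOpen U) {x : X} (hx : x ∈ U)
    (h : 0 < intrinsicSetEDist U A {x}) : x ∉ closure A := by
  intro hxA
  obtain ⟨r, hr, hrU⟩ := EMetric.isOpen_iff.1 hU x hx
  obtain ⟨a, ha, hxa⟩ := EMetric.mem_closure_iff.1 hxA _ (lt_min hr h)
  rw [edist_comm, hX a x, iInf_lt_iff] at hxa
  obtain ⟨γ, hγ⟩ := hxa
  -- A curve ending at `x` of length below `r` cannot leave the ball of radius `r`, so its length
  -- also bounds the intrinsic distance.
  have hγU : ∀ t, γ t ∈ U := by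
    intro t
    refine hrU (lt_of_le_of_lt ?_ (hγ.trans_le (min_le_left _ _)))
    have := eVariationOn.edist_le γ (mem_univ t) (mem_univ 1)
    rwa [γ.target] at this
  refine absurd (hγ.trans_le (min_le_right _ _)) (not_lt.2 ?_)
  exact iInf_le_of_le a (iInf_le_of_le ha (iInf_le_of_le x (iInf_le_of_le rfl
    (iInf_le_of_le γ (iInf_le _ hγU)))))

theorem exists_isCompact_closedBall_subset_disjoint {X : Type*} [MetricSpace X]
    [LocallyCompactSpace X] {U K : Set X} (hU : IsOpen U) {x : X} (hx : x ∈ U)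
    (hK : IsClosed K) (hxK : x ∉ K) :
    ∃ r, 0 < r ∧ IsCompact (Metric.closedBall x r) ∧ Metric.closedBall x r ⊆ U ∧
      Disjoint K (Metric.closedBall x r) := by
  obtain ⟨ρ, hρ, hc⟩ := Metric.exists_isCompact_closedBall x
  obtain ⟨s, hs, hsU⟩ := Metric.isOpen_iff.1 (hU.inter hK.isOpen_compl) x ⟨hx, hxK⟩
  have h1 : Metric.closedBall x (min ρ (s / 2)) ⊆ U ∩ Kᶜ :=
    (Metric.closedBall_subset_ball (by linarith [min_le_right ρ (s / 2)])).trans hsU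
  refine ⟨min ρ (s / 2), by positivity, hc.of_isClosed_subset Metric.isClosed_closedBall
    (Metric.closedBall_subset_closedBall (min_le_left _ _)), fun y hy => (h1 hy).1, ?_⟩
  exact disjoint_left.2 fun y hyK hy => (h1 hy).2 hyK

-- Averages and potentials of shrinking balls

theorem inner_indicatorConstLp_inv {X : Type*} [MeasurableSpace X] {μ : Measure X} {s : Set X}
    (hs : MeasurableSet s) (hμs : μ s ≠ ⊤) (f : Lp ℝ 2 μ) :
    inner ℝ (indicatorConstLp 2 hs hμs (μ.real s)⁻¹) f = ⨍ y in s, f y ∂μ := by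
  rw [L2.inner_indicatorConstLp_eq_inner_setIntegral, setAverage_eq, smul_eq_mul,
    real_inner_eq_re_inner, mul_comm]
  rfl

namespace DirichletForm

namespace IsGreenFunction

section

variable {X : Type*} [TopologicalSpace X] [MeasurableSpace X] {μ : Measure X}
  {E : DirichletForm μ} {Ω : Set X} {g : X → X → ℝ}

/-- The Green potential of a normalized indicator function is an average of the Green function. -/
theorem potential_eq_average (hg : E.IsGreenFunction Ω g) (hΩ : MeasurableSet Ω) {s : Set X}
    (hs : MeasurableSet s) (hμs : μ s ≠ ⊤) (hμ0 : μ s ≠ 0) (hsΩ : s ⊆ Ω) {u : E.domain}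
    (hu : E.IsGreenOperator Ω (indicatorConstLp 2 hs hμs (μ.real s)⁻¹) u) :
    ∀ᵐ y ∂μ, y ∈ Ω → IntegrableOn (g y) s μ ∧ (u : Lp ℝ 2 μ) y = ⨍ z in s, g y z ∂μ := by
  set f : Lp ℝ 2 μ := indicatorConstLp 2 hs hμs (μ.real s)⁻¹ with hf
  have hfe : f =ᵐ[μ] s.indicator fun _ => (μ.real s)⁻¹ := indicatorConstLp_coeFn
  have hc : (μ.real s)⁻¹ ≠ 0 := inv_ne_zero (by simp [measureReal_def, ENNReal.toReal_eq_zero_iff, *])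
  have hfL : f ∈ L2On μ Ω := by
    filter_upwards [hfe] with y hy hyΩ
    rw [hy, indicator_of_notMem fun h => hyΩ (hsΩ h)]
  filter_upwards [(ae_restrict_iff' hΩ).1 (hg.kernel f hfL u hu)] with y hy hyΩ
  obtain ⟨h1, h2⟩ := hy hyΩ
  have he : (fun z => g y z * f z) =ᵐ[μ] s.indicator fun z => g y z * (μ.real s)⁻¹ := by
    filter_upwards [hfe] with z hz
    rw [hz]
    by_cases hzs : z ∈ s <;> simp [hzs]
  constructor
  · have h3 : IntegrableOn (fun z => g y z * (μ.real s)⁻¹) s μ := by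
      refine (h1.mono_set hsΩ).congr_fun_ae ((ae_restrict_iff' hs).2 ?_)
      filter_upwards [hfe] with z hz hzs
      rw [hz, indicator_of_mem hzs]
    exact (integrable_mul_const_iff hc.isUnit _).1 h3
  · rw [h2, setAverage_eq, smul_eq_mul, mul_comm, ← integral_mul_const,
      integral_congr_ae (ae_restrict_of_ae he), setIntegral_indicator hs,
      inter_eq_right.2 hsΩ]

end

section Metric

variable {X : Type*} [MetricSpace X] [MeasurableSpace X] {μ : Measure X}
  {E : DirichletForm μ} {Ω : Set X} {g : X → X → ℝ}

theorem continuousAt_left (hg : E.IsGreenFunction Ω g) (hΩ : IsOpen Ω) {x y : X}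
    (hx : x ∈ Ω) (hy : y ∈ Ω) (hxy : y ≠ x) : ContinuousAt (g y) x := by
  have h1 : ContinuousAt (fun p : X × X => g p.1 p.2) (y, x) :=
    hg.continuousOn.continuousAt
      (((hΩ.prod hΩ).sdiff isClosed_diagonal).mem_nhds ⟨⟨hy, hx⟩, hxy⟩)
  exact h1.comp (f := fun z => (y, z)) (by fun_prop)

/-- The Green function with pole in a small ball is bounded outside a larger ball. -/
theorem exists_bound (hg : E.IsGreenFunction Ω g) {x : X} {r : ℝ} (hr : 0 < r)
    (hc : IsCompact (Metric.closedBall x r)) (hrΩ : Metric.closedBall x r ⊆ Ω) :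
    ∃ M, 0 < M ∧ ∀ z ∈ Metric.closedBall x (r / 2), ∀ y ∈ Ω, y ∉ Metric.ball x r → g z y ≤ M := by
  have hcl : closure (Metric.ball x r) ⊆ Metric.closedBall x r := Metric.closure_ball_subset_closedBall
  have hfr : frontier (Metric.ball x r) ⊆ Metric.sphere x r := Metric.frontier_ball_subset_sphere
  have hcomp : IsCompact (Metric.closedBall x (r / 2) ×ˢ frontier (Metric.ball x r)) :=
    (hc.of_isClosed_subset Metric.isClosed_closedBall
      (Metric.closedBall_subset_closedBall (by linarith))).prod
      (hc.of_isClosed_subset isClosed_frontier (frontier_subset_closure.trans hcl))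
  have hsub : Metric.closedBall x (r / 2) ×ˢ frontier (Metric.ball x r) ⊆
      (Ω ×ˢ Ω) \ diagonal X := by
    rintro ⟨z, y⟩ ⟨hz, hy⟩
    refine ⟨⟨hrΩ (Metric.closedBall_subset_closedBall (by linarith) hz),
      hrΩ (Metric.sphere_subset_closedBall (hfr hy))⟩, ?_⟩
    rintro (rfl : z = y)
    have h1 := Metric.mem_closedBall.1 hz
    rw [Metric.mem_sphere.1 (hfr hy)] at h1
    linarith
  obtain ⟨M, hM⟩ := hcomp.bddAbove_image (hg.continuousOn.mono hsub)
  -- Truncation requires a positive level.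
  refine ⟨max M 1, by positivity, fun z hz y hy hyr => ?_⟩
  have hsup := hg.sup_eq (Metric.ball x r) Metric.isOpen_ball
    (hc.of_isClosed_subset isClosed_closure hcl) (hcl.trans hrΩ) z
    (Metric.closedBall_subset_ball (by linarith) hz)
  have h1 : (g z y : EReal) ≤ (M : EReal) := by
    calc (g z y : EReal) ≤ ⨆ y ∈ Ω \ Metric.ball x r, (g z y : EReal) :=
          le_iSup₂_of_le y ⟨hy, hyr⟩ le_rfl
      _ ≤ M := by
          rw [hsup]
          refine iSup₂_le fun y' hy' => EReal.coe_le_coe_iff.2 ?_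
          exact hM ⟨(z, y'), ⟨hz, hy'⟩, rfl⟩
  exact (EReal.coe_le_coe_iff.1 h1).trans (le_max_left _ _)

variable [LocallyCompactSpace X] [SecondCountableTopology X] [BorelSpace X]
  [IsFiniteMeasureOnCompacts μ] [NullSingletonClass μ]
  [μ.IsOpenPosMeasure]

/-- The Green function, away from its pole, is a weak limit of truncated Green potentials: it
agrees with an element of `F⁰(Ω)` which is harmonic away from the pole. -/
theorem exists_truncation (hg : E.IsGreenFunction Ω g) (hloc : E.IsStronglyLocal)
    (hΩ : IsOpen Ω) (hspec : 0 < E.lambdaMin Ω) {x : X} {r : ℝ} (hr : 0 < r)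
    (hc : IsCompact (Metric.closedBall x r)) (hrΩ : Metric.closedBall x r ⊆ Ω) :
    ∃ w ∈ E.FZero Ω,
      (∀ᵐ y ∂μ, y ∈ Ω → y ∉ Metric.ball x r → (w : Lp ℝ 2 μ) y = g x y) ∧
      ∀ φ ∈ E.FCompact Ω, Disjoint (essSupport μ (φ : Lp ℝ 2 μ)) (Metric.closedBall x r) →
        E.form w φ = 0 := by
  have hxΩ : x ∈ Ω := hrΩ (Metric.mem_closedBall_self hr.le)
  obtain ⟨M, hM, hgM⟩ := hg.exists_bound hr hc hrΩ
  obtain ⟨c, hc0, hpoin⟩ := exists_poincare hspec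
  -- The shift by `2` keeps every ball, including `n = 0`, within radius `r / 2`, where `M` is
  -- valid.
  let s : ℕ → Set X := fun n => Metric.ball x (r / (n + 2))
  have hsr : ∀ n, s n ⊆ Metric.closedBall x (r / 2) := fun n =>
    Metric.ball_subset_closedBall.trans (Metric.closedBall_subset_closedBall
      (div_le_div_of_nonneg_left hr.le two_pos (by linarith [n.cast_nonneg (α := ℝ)])))
  have hsr' : ∀ n, s n ⊆ Metric.closedBall x r := fun n =>
    (hsr n).trans (Metric.closedBall_subset_closedBall (by linarith))
  have hsm : ∀ n, MeasurableSet (s n) := fun n => Metric.isOpen_ball.measurableSet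
  have hst : ∀ n, μ (s n) ≠ ⊤ := fun n =>
    ((measure_mono (hsr' n)).trans_lt hc.measure_lt_top).ne
  have hs0 : ∀ n, μ (s n) ≠ 0 := fun n =>
    (Metric.isOpen_ball.measure_pos μ ⟨x, Metric.mem_ball_self (by positivity)⟩).ne'
  -- All estimates below say that an average stays in a closed convex set: a half-line, a closed
  -- ball or `{0}`.
  have hav : ∀ (n : ℕ) (f : X → ℝ) (t : Set ℝ), Convex ℝ t → IsClosed t →
      (∀ᵐ z ∂μ, z ∈ s n → f z ∈ t) → IntegrableOn f (s n) μ → ⨍ z in s n, f z ∂μ ∈ t :=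
    fun n f t ht htc hft hfi => ht.set_average_mem htc (hs0 n) (hst n)
      ((ae_restrict_iff' (hsm n)).2 hft) hfi
  have hfL : ∀ n, indicatorConstLp 2 (hsm n) (hst n) (μ.real (s n))⁻¹ ∈ L2On μ Ω := fun n => by
    filter_upwards [indicatorConstLp_coeFn (p := 2) (hs := hsm n) (hμs := hst n)
      (c := (μ.real (s n))⁻¹)] with y hy hyΩ
    rw [hy, indicator_of_notMem fun h => hyΩ (hrΩ (hsr' n h))]
  choose u hu using fun n => exists_isGreenOperator hspec (hfL n)
  have huF : ∀ n, u n ∈ E.FZero Ω := fun n => (hu n).1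
  have hform : ∀ n, ∀ φ ∈ E.FZero Ω, E.form (u n) φ = ⨍ z in s n, (φ : Lp ℝ 2 μ) z ∂μ := by
    intro n φ hφ
    rw [(hu n).2.2 φ hφ, inner_neg_left, neg_neg, inner_indicatorConstLp_inv]
  have hpot : ∀ n, ∀ᵐ y ∂μ, y ∈ Ω →
      IntegrableOn (g y) (s n) μ ∧ (u n : Lp ℝ 2 μ) y = ⨍ z in s n, g y z ∂μ := fun n =>
    hg.potential_eq_average hΩ.measurableSet (hsm n) (hst n) (hs0 n) ((hsr' n).trans hrΩ) (hu n)
  have hzero : ∀ n, ∀ᵐ y ∂μ, y ∉ Ω → (u n : Lp ℝ 2 μ) y = 0 := fun n =>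
    ae_eq_zero_of_mem_FZero hΩ (huF n)
  have hu0 : ∀ n, ∀ᵐ y ∂μ, 0 ≤ (u n : Lp ℝ 2 μ) y := by
    intro n
    filter_upwards [hpot n, hzero n] with y h1 h2
    by_cases hy : y ∈ Ω
    · obtain ⟨h3, h4⟩ := h1 hy
      rw [h4]
      refine hav n (g y) (Ici 0) (convex_Ici 0) isClosed_Ici ?_ h3
      -- Here `y` may lie in `s n`, and `g` is uncontrolled on the diagonal; points are null.
      filter_upwards [compl_mem_ae_iff.2 (measure_singleton (μ := μ) y)] with z hzy hz
      exact hg.nonneg y hy z (hrΩ (hsr' n hz)) (Ne.symm hzy)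
    · exact (h2 hy).ge
  have huM : ∀ n, ∀ᵐ y ∂μ, y ∉ Metric.ball x r → (u n : Lp ℝ 2 μ) y ≤ M := by
    intro n
    filter_upwards [hpot n, hzero n] with y h1 h2 hyr
    by_cases hy : y ∈ Ω
    · obtain ⟨h3, h4⟩ := h1 hy
      rw [h4]
      refine hav n (g y) (Iic M) (convex_Iic M) isClosed_Iic (Eventually.of_forall ?_) h3
      intro z hz
      have hzy : y ≠ z := by
        rintro rfl
        exact hyr (Metric.closedBall_subset_ball (by linarith) (hsr n hz))
      rw [hg.symm y hy z (hrΩ (hsr' n hz)) hzy]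
      exact hgM z (hsr n hz) y hy hyr
    · exact (h2 hy).trans_le hM.le
  choose w hwmax _ using fun n => DirichletForm.exists_truncation (u n) hM
  have hw : ∀ n, ∀ᵐ y ∂μ, (w n : Lp ℝ 2 μ) y = min ((u n : Lp ℝ 2 μ) y) M := by
    intro n
    filter_upwards [hwmax n, hu0 n] with y h1 h2
    rw [h1, max_eq_left h2]
  have hwF : ∀ n, w n ∈ E.FZero Ω := fun n => truncation_mem_FZero (huF n) hM (hwmax n)
  have hwM : ∀ n, ∀ᵐ y ∂μ, |(w n : Lp ℝ 2 μ) y| ≤ M := by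
    intro n
    filter_upwards [hw n, hu0 n] with y h1 h2
    rw [h1, abs_of_nonneg (le_min h2 hM.le)]
    exact min_le_right _ _
  -- The uniform energy bound: `E(u n, w n)` is the average of `w n` over `s n`.
  have hwE : ∀ n, E.form (w n) (w n) ≤ M := by
    intro n
    refine (form_truncation_le hM (hu0 n) (hw n)).trans ?_
    rw [hform n _ (hwF n)]
    refine hav n _ (Iic M) (convex_Iic M) isClosed_Iic ?_
      (integrableOn_Lp_of_measure_ne_top _ (by norm_num) (hst n))
    filter_upwards [hwM n] with z hz _
    exact (le_abs_self _).trans hz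
  have hwE1 : ∀ n, E.energyOne (w n) ≤ M + M / c := by
    intro n
    refine add_le_add (hwE n) ?_
    rw [le_div_iff₀' hc0]
    exact (hpoin _ (hwF n)).trans (hwE n)
  have hlim : ∀ᵐ y ∂μ, Tendsto (fun n => (w n : Lp ℝ 2 μ) y) atTop
      (𝓝 (Ω.indicator (fun y => min (g x y) M) y)) := by
    filter_upwards [ae_all_iff.2 hpot, ae_all_iff.2 hzero, ae_all_iff.2 hw,
      compl_mem_ae_iff.2 (measure_singleton (μ := μ) x)] with y h1 h2 h3 hyx
    simp only [h3]
    by_cases hy : y ∈ Ω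
    · rw [indicator_of_mem hy, ← hg.symm y hy x hxΩ hyx]
      refine Tendsto.min ?_ tendsto_const_nhds
      rw [Metric.tendsto_atTop]
      intro ε hε
      obtain ⟨δ, hδ, hgδ⟩ := Metric.continuousAt_iff.1 (hg.continuousAt_left hΩ hxΩ hy hyx)
        (ε / 2) (by positivity)
      have hrad : Tendsto (fun n : ℕ => r / ((n : ℝ) + 2)) atTop (𝓝 0) :=
        tendsto_const_nhds.div_atTop
          (tendsto_atTop_add_const_right _ _ tendsto_natCast_atTop_atTop)
      obtain ⟨N, hN⟩ := eventually_atTop.1 (hrad.eventually_lt_const hδ)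
      refine ⟨N, fun n hn => ?_⟩
      rw [(h1 n hy).2]
      refine lt_of_le_of_lt (b := ε / 2) ?_ (by linarith)
      refine hav n (g y) (Metric.closedBall (g y x) (ε / 2)) (convex_closedBall _ _)
        Metric.isClosed_closedBall (Eventually.of_forall fun z hz => ?_) (h1 n hy).1
      exact (hgδ (lt_trans hz (hN n hn))).le
    · simp only [indicator_of_notMem hy, h2 _ hy, min_eq_left hM.le]
      exact tendsto_const_nhds
  obtain ⟨v, hv, hvE, hvL⟩ := exists_weak_limit_FZero hwF hwE1 dense_integrable_L2
    fun h hh => ⟨_, tendsto_inner_of_bounded hwM hlim hh⟩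
  refine ⟨v, hv, ?_, fun φ hφ hdisj => ?_⟩
  · filter_upwards [ae_eq_of_weak_limit_of_bounded hwM hlim hvL] with y h1 hy hyr
    rw [h1, indicator_of_mem hy, min_eq_left]
    exact hgM x (Metric.mem_closedBall_self (by positivity)) y hy hyr
  · refine tendsto_nhds_unique (hvE φ) (tendsto_const_nhds.congr fun n => ?_)
    have h1 : E.form (u n) φ = 0 := by
      rw [hform n φ (FCompact_subset_FZero hφ)]
      refine hav n _ {0} (convex_singleton 0) isClosed_singleton ?_
        (integrableOn_Lp_of_measure_ne_top _ (by norm_num) (hst n))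
      filter_upwards [ae_eq_zero_of_notMem_essSupport (μ := μ) (φ : Lp ℝ 2 μ)] with z hz hzs
      exact hz fun h => disjoint_left.1 hdisj h (hsr' n hzs)
    -- Truncation changes `u n` only inside the ball, so the difference is constantly `0` near the
    -- support of `φ`.
    have h2 : ∀ᵐ y ∂μ, y ∉ Metric.closedBall x r → ((u n - w n : E.domain) : Lp ℝ 2 μ) y = 0 := by
      filter_upwards [huM n, hw n, Lp.coeFn_sub (u n : Lp ℝ 2 μ) (w n)] with y h3 h4 h5 hy
      rw [Submodule.coe_sub, h5, Pi.sub_apply, h4,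
        min_eq_left (h3 fun h => hy (Metric.ball_subset_closedBall h)), sub_self]
    have h3 : E.form (u n - w n) φ = 0 := by
      refine hloc _ _ (hc.of_isClosed_subset (isClosed_essSupport _)
        (essSupport_subset_of_isClosed Metric.isClosed_closedBall h2)) hφ.1
        ⟨(Metric.closedBall x r)ᶜ, 0, Metric.isClosed_closedBall.isOpen_compl,
          hdisj.subset_compl_right, ?_⟩
      exact (ae_restrict_iff' Metric.isClosed_closedBall.measurableSet.compl).2 h2
    rw [map_sub, LinearMap.sub_apply, h1] at h3
    linarith

end Metric

end IsGreenFunction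

end DirichletForm

end

-- Localization away from the pole

theorem lemma4p6 {X : Type*} [MetricSpace X] [CompleteSpace X] [LocallyCompactSpace X]
    [TopologicalSpace.SeparableSpace X] (hX : IsLengthSpace X)
    [MeasurableSpace X] [BorelSpace X]
    (μ : Measure X) [μ.Regular] [NullSingletonClass μ] [μ.IsOpenPosMeasure]
    (E : DirichletForm μ) (hreg : E.IsRegular) (hloc : E.IsStronglyLocal)
    (Ω : Set X) (hΩ_open : IsOpen Ω) (hΩ_ne : Ω.Nonempty) (hΩ_bdd : Bornology.IsBounded Ω)
    (hΩ_diam : Metric.ediam Ω ≤ Metric.ediam (univ : Set X) / 5)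
    (hΩ_spec : 0 < E.lambdaMin Ω)
    (g : X → X → ℝ) (hg : E.IsGreenFunction Ω g) (x : X) (hx : x ∈ Ω) :
    E.MemFZeroLoc Ω (Ω \ {x}) (fun y => g x y) ∧
      E.IsHarmonicOn (Ω \ {x}) (fun y => g x y) := by
  have : SecondCountableTopology X := UniformSpace.secondCountable_of_separable X
  -- Each requirement concerns a set whose closure misses `x`; the radius is chosen so that the ball
  -- misses it too.
  have key : ∀ K : Set X, IsClosed K → x ∉ K → ∃ (r : ℝ) (w : E.domain),
      Disjoint K (Metric.closedBall x r) ∧ w ∈ E.FZero Ω ∧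
      (∀ᵐ y ∂μ, y ∈ Ω → y ∉ Metric.ball x r → (w : Lp ℝ 2 μ) y = g x y) ∧
      (∀ φ ∈ E.FCompact Ω, Disjoint (essSupport μ (φ : Lp ℝ 2 μ)) (Metric.closedBall x r) →
        E.form w φ = 0) ∧ 0 < r := by
    intro K hK hxK
    obtain ⟨r, hr, hc, hrΩ, hd⟩ :=
      exists_isCompact_closedBall_subset_disjoint hΩ_open hx hK hxK
    obtain ⟨w, hw, hwg, hwφ⟩ := hg.exists_truncation hloc hΩ_open hΩ_spec hr hc hrΩ
    exact ⟨r, w, hd, hw, hwg, hwφ, hr⟩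
  have hrep : ∀ A : Set X, MeasurableSet A → A ⊆ Ω → x ∉ closure A →
      ∃ w ∈ E.FZero Ω, ∀ᵐ y ∂(μ.restrict A), (w : Lp ℝ 2 μ) y = g x y := by
    intro A hA hAΩ hxA
    obtain ⟨r, w, hd, hw, hwg, -⟩ := key _ isClosed_closure hxA
    refine ⟨w, hw, (ae_restrict_iff' hA).2 ?_⟩
    filter_upwards [hwg] with y hy hyA
    exact hy (hAΩ hyA) fun h =>
      disjoint_left.1 hd (subset_closure hyA) (Metric.ball_subset_closedBall h)
  have hL2 : MemL2Loc μ (Ω \ {x}) (fun y => g x y) := by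
    intro K hK hKc
    obtain ⟨w, -, hw⟩ := hrep K hKc.measurableSet (hK.trans sdiff_subset)
      (by rw [hKc.isClosed.closure_eq]; exact fun h => (hK h).2 rfl)
    exact ((Lp.memLp (w : Lp ℝ 2 μ)).restrict K).ae_eq hw
  refine ⟨⟨hL2, fun A hA hAV _ hd => ?_⟩, ⟨hL2, fun V hV _ hVU => ?_⟩, fun φ hφ => ?_⟩
  -- Here `Ω \ (Ω \ {x})` is `{x}`, so positive intrinsic distance keeps `x` out of the closure of
  -- `A`.
  · rw [sdiff_sdiff_right_self, inter_eq_right.2 (singleton_subset_iff.2 hx)] at hd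
    exact hrep A hA.measurableSet (hAV.trans sdiff_subset)
      (notMem_closure_of_intrinsicSetEDist_pos hX hΩ_open hx hd)
  · obtain ⟨w, -, hw⟩ := hrep V hV.measurableSet (subset_closure.trans (hVU.trans sdiff_subset))
      fun h => (hVU h).2 rfl
    exact ⟨w, hw.mono fun y hy => hy.symm⟩
  · obtain ⟨r, w, hd, -, hwg, hwφ, hr⟩ := key _ (isClosed_essSupport (μ := μ) (φ : Lp ℝ 2 μ))
      fun h => (hφ.2 h).2 rfl
    have hW : IsOpen (Ω \ Metric.closedBall x r) := hΩ_open.sdiff Metric.isClosed_closedBall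
    refine ⟨w, ⟨Ω \ Metric.closedBall x r, hW, fun y hy => ⟨(hφ.2 hy).1, disjoint_left.1 hd hy⟩,
      sdiff_subset_sdiff_right (singleton_subset_iff.2 (Metric.mem_closedBall_self hr.le)), ?_⟩,
      hwφ φ (DirichletForm.FCompact_mono sdiff_subset hφ) hd⟩
    refine (ae_restrict_iff' hW.measurableSet).2 ?_
    filter_upwards [hwg] with y hy hyW
    exact hy hyW.1 fun h => hyW.2 (Metric.ball_subset_closedBall h)
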